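/- Let $\mathcal{C}$ be a finitely cocomplete homological category, that is, a pointed, regular (in particular finitely complete) and protomodular category with finite colimits. Let $x\colon X\to D$, $y\colon Y\to D$ and $w\colon W\to D$ be arbitrary morphisms of $\mathcal{C}$ (a weighted cospan with weight $w$). Let $(W+X)\times_W(W+Y)$ be the pullback of the retractions $\langle 1_W,0\rangle\colon W+X\to W$ and $\langle 1_W,0\rangle\colon W+Y\to W$, and let $K$ be the kernel of the canonical morphism $W+X+Y\to (W+X)\times_W(W+Y)$ whose restrictions to $W$, $X$, $Y$ are $(\iota_W,\iota_W)$, $(\iota_X,0)$, $(0,\iota_Y)$. The $(W,w)$-weighted subobject commutator $[(X,x),(Y,y)]_{(W,w)}\leq D$ is the image of the composite $K\to W+X+Y\to D$, where the second morphism is induced by $w$, $x$, $y$. For objects $A,B,E$, let $A\diamond B$ be the kernel of the canonical morphism $A+B\to A\times B$ (with restrictions $(1_A,0)$ and $(0,1_B)$), and let $A\diamond B\diamond E$ be the kernel of the canonical morphism $A+B+E\to (A+B)\times(A+E)\times(B+E)$ (with restrictions $(i_A,i_A,0)$, $(i_B,0,i_B)$ and $(0,i_E,i_E)$). For morphisms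 $a\colon A\to D$, $b\colon B\to D$, $e\colon E\to D$, the binary and ternary Higgins commutators $[a,b]\leq D$ and $[a,b,e]\leq D$ are the images of the induced composites $A\diamond B\to A+B\to D$ and $A\diamond B\diamond E\to A+B+E\to D$. If $a,b,e$ are monomorphisms, these are the commutators $[A,B]$ and $[A,B,E]$ of the subobjects $A,B,E$ of $D$. Theorem. Write $\mathrm{im}(f)\colon \mathrm{Im}(f)\to D$ for the image inclusion of a morphism $f$ with codomain $D$. In the lattice of subobjects of $D$, \[ [(X,x),(Y,y)]_{(W,w)} = [x,y]\vee[x,y,\mathrm{im}(w)] \] and also \[ [(X,x),(Y,y)]_{(W,w)} = [\mathrm{im}(x),\mathrm{im}(y)]\vee[\mathrm{im}(x),\mathrm{im}(y),\mathrm{im}(w)]. \] That is, $[(X,x),(Y,y)]_{(W,w)}=[X,Y]\vee[X,Y,\mathrm{Im}(w)]$, whether $[X,Y]$ and $[X,Y,\mathrm{Im}(w)]$ are formed with $x$ and $y$ themselves or with their images in $D$. -/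

import Mathlib

open CategoryTheory CategoryTheory.Limits

universe v u

/-- A category with pullbacks is *protomodular* when, for every `v : E ⟶ B`, the change-of-base
functor `v* : Pt(B) ⥤ Pt(E)` between the categories of points (split epimorphisms with a chosen
section) reflects isomorphisms. Here `(p, s)` and `(p', s')` are points over `B`, `f` is a morphism
of points, and `pullback.map …` is the underlying morphism of `v* f`. -/
class Protomodular (C : Type u) [Category.{v} C] [HasPullbacks C] : Prop where
  isIso_of_isIso_pullback {A A' B E : C} (v : E ⟶ B)
    (p : A ⟶ B) (s : B ⟶ A) (_ : s ≫ p = 𝟙 B)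
    (p' : A' ⟶ B) (s' : B ⟶ A') (_ : s' ≫ p' = 𝟙 B)
    (f : A ⟶ A') (hp : f ≫ p' = p) (_ : s ≫ f = s')
    (_ : IsIso (pullback.map p v p' v f (𝟙 E) (𝟙 B) (by simp [hp]) (by simp))) :
    IsIso f

/-- A *homological* category: pointed, regular and protomodular. -/
class HomologicalCategory (C : Type u) [Category.{v} C] : Prop
    extends Regular C, HasZeroObject C, Protomodular C

noncomputable section

namespace WeightedCommutator

variable {C : Type u} [Category.{v} C] [HomologicalCategory C] [HasZeroMorphisms C]
  [HasFiniteColimits C]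

/-- The retraction `⟨1, 0⟩ : W + X ⟶ W` of the coproduct inclusion of `W`. -/
abbrev retr (W X : C) : W ⨿ X ⟶ W := coprod.desc (𝟙 W) 0

/-- The comparison morphism `W + X + Y ⟶ (W + X) ×_W (W + Y)`, where the pullback is that of the
retractions onto `W`: it is `(ι_W, ι_W)` on `W`, `(ι_X, 0)` on `X` and `(0, ι_Y)` on `Y`. -/
def comparison (W X Y : C) : (W ⨿ X) ⨿ Y ⟶ pullback (retr W X) (retr W Y) :=
  coprod.desc
    (coprod.desc
      (pullback.lift coprod.inl coprod.inl (by rw [coprod.inl_desc, coprod.inl_desc]))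
      (pullback.lift coprod.inr 0 (by rw [coprod.inr_desc, zero_comp])))
    (pullback.lift 0 coprod.inr (by rw [coprod.inr_desc, zero_comp]))

/-- The `(W, w)`-weighted subobject commutator `[(X, x), (Y, y)]_{(W, w)}` of `x` and `y`: the
direct image along `W + X + Y ⟶ D` of the kernel of the comparison morphism. -/
def weightedCommutator {W X Y D : C} (w : W ⟶ D) (x : X ⟶ D) (y : Y ⟶ D) : Subobject D :=
  imageSubobject (kernel.ι (comparison W X Y) ≫ coprod.desc (coprod.desc w x) y)

/-- The canonical morphism `K + L ⟶ K × L`, given by the identity matrix. -/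
def sumToProd (K L : C) : K ⨿ L ⟶ K ⨯ L :=
  coprod.desc (prod.lift (𝟙 K) 0) (prod.lift 0 (𝟙 L))

/-- The binary co-smash product `K ⋄ L`. -/
abbrev coSmash (K L : C) : C := kernel (sumToProd K L)

/-- The binary Higgins commutator: the image of `K ⋄ L ⟶ K + L ⟶ D`. When `k` and `l` are
monomorphisms, this is the commutator `[K, L]` of the subobjects which they represent. -/
def higgins {K L D : C} (k : K ⟶ D) (l : L ⟶ D) : Subobject D :=
  imageSubobject (kernel.ι (sumToProd K L) ≫ coprod.desc k l)

/-- The canonical morphism `K + L + M ⟶ (K + L) × (K + M) × (L + M)`: it is `(i_K, i_K, 0)` on `K`,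
`(i_L, 0, i_L)` on `L` and `(0, i_M, i_M)` on `M`. -/
def sumToProd₃ (K L M : C) : (K ⨿ L) ⨿ M ⟶ (K ⨿ L) ⨯ ((K ⨿ M) ⨯ (L ⨿ M)) :=
  coprod.desc
    (coprod.desc
      (prod.lift coprod.inl (prod.lift coprod.inl 0))
      (prod.lift coprod.inr (prod.lift 0 coprod.inl)))
    (prod.lift 0 (prod.lift coprod.inr coprod.inr))

/-- The ternary co-smash product `K ⋄ L ⋄ M`. -/
abbrev coSmash₃ (K L M : C) : C := kernel (sumToProd₃ K L M)

/-- The ternary Higgins commutator: the image of `K ⋄ L ⋄ M ⟶ K + L + M ⟶ D`. When `k`, `l` and `m`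
are monomorphisms, this is the commutator `[K, L, M]` of the subobjects which they represent. -/
def higgins₃ {K L M D : C} (k : K ⟶ D) (l : L ⟶ D) (m : M ⟶ D) : Subobject D :=
  imageSubobject (kernel.ι (sumToProd₃ K L M) ≫ coprod.desc (coprod.desc k l) m)

end WeightedCommutator

end

open WeightedCommutator

noncomputable section

namespace WeightedCommutator

attribute [local simp] coprod.inl_desc coprod.inr_desc coprod.inl_desc_assoc coprod.inr_desc_assoc
  prod.lift_fst prod.lift_snd prod.lift_fst_assoc prod.lift_snd_assoc
  pullback.lift_fst pullback.lift_snd pullback.lift_fst_assoc pullback.lift_snd_assoc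

/-! ### Extremal epimorphisms and images via factorization through subobjects -/

section Regular

variable {C : Type u} [Category.{v} C] [Regular C]

/-! Let K be the kernel of the comparison morphism. The retraction W+X+Y → X+Y that kills W
restricts to a split epimorphism K → X⋄Y with kernel X⋄Y⋄W. By protomodularity the kernel and the
section of a point are jointly extremally epic, so the image of K in D is the join of the images of
X⋄Y and X⋄Y⋄W. This is `weightedCommutator_eq_sup`, with w itself in the ternary term.

To pass to images, it suffices that extremal epimorphisms on W, X and Y induce one on K. As K arises
by twice taking the kernel of a split epimorphism, this follows from two uses of
`extremalEpi_kernel_of_point`. Hence the weighted commutator does not change when w, x or y is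
replaced by its image, and the decomposition gives both equations. -/

theorem factors_of_isIso_pullback_arrow {A D : C} (f : A ⟶ D) (T : Subobject D)
    [IsIso ((Subobject.pullback f).obj T).arrow] : T.Factors f := by
  have h := Subobject.factors_comp_arrow (P := (Subobject.pullback f).obj T)
    (inv ((Subobject.pullback f).obj T).arrow)
  rwa [IsIso.inv_hom_id, pullback_factors_iff, Category.id_comp] at h

theorem factors_of_extremalEpi_comp {A B D : C} (e : A ⟶ B) [ExtremalEpi e] (f : B ⟶ D)
    (T : Subobject D) (h : T.Factors (e ≫ f)) : T.Factors f := by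
  have := ExtremalEpi.isIso e
    (Subobject.factorThru _ e ((pullback_factors_iff f T e).2 h))
    ((Subobject.pullback f).obj T).arrow (Subobject.factorThru_arrow _ _ _)
  exact factors_of_isIso_pullback_arrow f T

/-- Reduces extremality to a test on subobjects, the form in which `factors_of_point` can be
applied. -/
theorem extremalEpi_of_factors {A B : C} (e : A ⟶ B)
    (h : ∀ T : Subobject B, T.Factors e → T.Factors (𝟙 B)) : ExtremalEpi e := by
  refine ExtremalEpi.mk_of_hasEqualizers _ fun Z p i fac hi => ?_
  obtain ⟨r, hr⟩ := (Subobject.mk_factors_iff i (𝟙 B)).1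
    (h (Subobject.mk i) ((Subobject.mk_factors_iff i e).2 ⟨p, fac⟩))
  have : IsSplitEpi i := ⟨⟨⟨r, hr⟩⟩⟩
  exact isIso_of_mono_of_isSplitEpi i

theorem imageSubobject_le_iff {A D : C} (f : A ⟶ D) (T : Subobject D) :
    imageSubobject f ≤ T ↔ T.Factors f :=
  ⟨fun h => Subobject.factors_of_le f h (by
      simpa using imageSubobject_factors_comp_self f (𝟙 A)),
    fun h => imageSubobject_le f (T.factorThru f h) (T.factorThru_arrow f h)⟩

theorem imageSubobject_extremalEpi_comp {A B D : C} (e : A ⟶ B) [ExtremalEpi e] (f : B ⟶ D) :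
    imageSubobject (e ≫ f) = imageSubobject f :=
  le_antisymm (imageSubobject_comp_le e f) ((imageSubobject_le_iff _ _).2
    (factors_of_extremalEpi_comp e f _ ((imageSubobject_le_iff _ _).1 le_rfl)))

theorem extremalEpi_coprod_map [HasFiniteColimits C] {A B A' B' : C} (e : A ⟶ A') (e' : B ⟶ B')
    [ExtremalEpi e] [ExtremalEpi e'] : ExtremalEpi (coprod.map e e') := by
  refine extremalEpi_of_factors _ fun T hT => ?_
  have h₁ : T.Factors (coprod.inl : A' ⟶ A' ⨿ B') :=
    factors_of_extremalEpi_comp e _ T (by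
      rw [← coprod.inl_map e e']; exact Subobject.factors_of_factors_right _ hT)
  have h₂ : T.Factors (coprod.inr : B' ⟶ A' ⨿ B') :=
    factors_of_extremalEpi_comp e' _ T (by
      rw [← coprod.inr_map e e']; exact Subobject.factors_of_factors_right _ hT)
  refine (Subobject.factors_iff _ _).2 ⟨coprod.desc (T.factorThru _ h₁) (T.factorThru _ h₂), ?_⟩
  change coprod.desc (T.factorThru _ h₁) (T.factorThru _ h₂) ≫ T.arrow = _
  ext <;> simp

instance {A D : C} (f : A ⟶ D) : ExtremalEpi (factorThruImage f) :=
  have : StrongEpi (factorThruImage f) := inferInstance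
  inferInstance

end Regular

theorem comp_mono_eq_zero_iff {C : Type u} [Category.{v} C] [HasZeroMorphisms C] {A B D : C}
    (f : A ⟶ B) (m : B ⟶ D) [Mono m] : f ≫ m = 0 ↔ f = 0 :=
  ⟨fun h => zero_of_comp_mono m h, fun h => by rw [h, zero_comp]⟩

/-! ### Points, their kernels and protomodularity -/

section Points

variable {C : Type u} [Category.{v} C] [HomologicalCategory C] [HasZeroMorphisms C]

/-- In a homological category, the kernel and the section of a point are jointly extremally epic:
a monomorphism through which both of them factor is an isomorphism. The kernel `k` only needs to be
a weak one. -/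
theorem isIso_of_mono_of_point {A B N M : C} (p : A ⟶ B) (s : B ⟶ A) (hs : s ≫ p = 𝟙 B)
    (k : N ⟶ A) (hk : ∀ ⦃Z : C⦄ (z : Z ⟶ A), z ≫ p = 0 → ∃ l, l ≫ k = z)
    (m : M ⟶ A) [Mono m] (k' : N ⟶ M) (hk' : k' ≫ m = k) (s' : B ⟶ M) (hs' : s' ≫ m = s) :
    IsIso m := by
  obtain ⟨O, hO⟩ := HasZeroObject.zero (C := C)
  -- Base change along 0 → B restricts `m` to kernels. That restriction is a monomorphism, split
  -- because the kernel of `p` factors through `k'`.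
  refine Protomodular.isIso_of_isIso_pullback (0 : O ⟶ B) (m ≫ p) s'
    (by rw [← Category.assoc, hs', hs]) p s hs m rfl hs' ?_
  obtain ⟨l, hl⟩ := hk (pullback.fst p (0 : O ⟶ B)) (by rw [pullback.condition, comp_zero])
  have hmono : Mono (pullback.map (m ≫ p) (0 : O ⟶ B) p 0 m (𝟙 O) (𝟙 B) (by simp) (by simp)) := by
    refine ⟨fun a b h => ?_⟩
    have h' := congrArg (fun t => t ≫ pullback.fst p (0 : O ⟶ B)) h
    simp only [Category.assoc, pullback.lift_fst, pullback.map] at h'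
    refine pullback.hom_ext ?_ (hO.eq_of_tgt _ _)
    rw [← cancel_mono m]
    simpa only [Category.assoc] using h'
  have hsplit : IsSplitEpi
      (pullback.map (m ≫ p) (0 : O ⟶ B) p 0 m (𝟙 O) (𝟙 B) (by simp) (by simp)) := by
    refine ⟨⟨⟨pullback.lift (l ≫ k') (pullback.snd p (0 : O ⟶ B)) ?_, ?_⟩⟩⟩
    · rw [Category.assoc, reassoc_of% hk', reassoc_of% hl, pullback.condition]
    · refine pullback.hom_ext ?_ (hO.eq_of_tgt _ _)
      simp [pullback.map, hk', hl]
  exact isIso_of_mono_of_isSplitEpi _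

/-- A subobject contains the image of a morphism on the total object of a point as soon as it
contains the images of its restrictions to the kernel and to the section. -/
theorem factors_of_point {A B N D : C} (p : A ⟶ B) (s : B ⟶ A) (hs : s ≫ p = 𝟙 B)
    (k : N ⟶ A) (hk : ∀ ⦃Z : C⦄ (z : Z ⟶ A), z ≫ p = 0 → ∃ l, l ≫ k = z)
    (f : A ⟶ D) (T : Subobject D) (hkf : T.Factors (k ≫ f)) (hsf : T.Factors (s ≫ f)) :
    T.Factors f := by
  have := isIso_of_mono_of_point p s hs k hk ((Subobject.pullback f).obj T).arrow
    (Subobject.factorThru _ k ((pullback_factors_iff f T k).2 hkf))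
    (Subobject.factorThru_arrow _ _ _)
    (Subobject.factorThru _ s ((pullback_factors_iff f T s).2 hsf))
    (Subobject.factorThru_arrow _ _ _)
  exact factors_of_isIso_pullback_arrow f T

/-- The image of a morphism on the total object of a point is the join of the images of its
restrictions to the kernel and to the section. -/
theorem imageSubobject_eq_sup_of_point [HasFiniteColimits C] {A B N D : C} (p : A ⟶ B) (s : B ⟶ A)
    (hs : s ≫ p = 𝟙 B) (k : N ⟶ A) (hk : ∀ ⦃Z : C⦄ (z : Z ⟶ A), z ≫ p = 0 → ∃ l, l ≫ k = z)
    (f : A ⟶ D) : imageSubobject f = imageSubobject (s ≫ f) ⊔ imageSubobject (k ≫ f) :=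
  le_antisymm
    ((imageSubobject_le_iff _ _).2 (factors_of_point p s hs k hk f _
      ((imageSubobject_le_iff _ _).1 le_sup_right) ((imageSubobject_le_iff _ _).1 le_sup_left)))
    (sup_le (imageSubobject_comp_le s f) (imageSubobject_comp_le k f))

/-- A morphism of points whose underlying morphism is an extremal epimorphism restricts to an
extremal epimorphism between the kernels. -/
theorem extremalEpi_kernel_of_point {A B N A' B' N' : C} (p : A ⟶ B) (s : B ⟶ A)
    (hs : s ≫ p = 𝟙 B) (p' : A' ⟶ B') (s' : B' ⟶ A')
    (f : A ⟶ A') [ExtremalEpi f] (g : B ⟶ B') (hp : f ≫ p' = p ≫ g) (hs' : s ≫ f = g ≫ s')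
    (k : N ⟶ A) (hk : ∀ ⦃Z : C⦄ (z : Z ⟶ A), z ≫ p = 0 → ∃ l, l ≫ k = z)
    (k' : N' ⟶ A') [Mono k'] (hk' : k' ≫ p' = 0) (φ : N ⟶ N') (hφ : φ ≫ k' = k ≫ f) :
    ExtremalEpi φ := by
  refine extremalEpi_of_factors φ fun T hT => ?_
  -- By regularity the pullback of `f` along `k'` is again an extremal epimorphism, so factorization
  -- may be checked on the pullback.
  refine factors_of_extremalEpi_comp (pullback.fst k' f) (𝟙 N') T ?_
  rw [Category.comp_id]
  have hcond : (pullback.snd k' f ≫ p) ≫ g = 0 := by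
    rw [Category.assoc, ← hp, ← pullback.condition_assoc, hk', comp_zero]
  have hsec : (0 : kernel g ⟶ N') ≫ k' = (kernel.ι g ≫ s) ≫ f := by
    rw [zero_comp, Category.assoc, hs', kernel.condition_assoc, zero_comp]
  -- The pullback is itself a point over the kernel of `g`, with weak kernel `N`. Its section
  -- becomes zero in `N'`, so only `φ` has to factor through `T`. Nothing is required of `g`.
  refine factors_of_point (kernel.lift g (pullback.snd k' f ≫ p) hcond)
    (pullback.lift 0 (kernel.ι g ≫ s) hsec) ?_ (pullback.lift φ k hφ) ?_ _ T ?_ ?_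
  · rw [← cancel_mono (kernel.ι g)]
    simp [hs]
  · intro Z z hz
    have hz' := congrArg (fun t => t ≫ kernel.ι g) hz
    simp only [Category.assoc, kernel.lift_ι, zero_comp] at hz'
    obtain ⟨l, hl⟩ := hk (z ≫ pullback.snd k' f) (by rw [Category.assoc, hz'])
    refine ⟨l, pullback.hom_ext ?_ ?_⟩
    · rw [← cancel_mono k']
      simp only [Category.assoc, pullback.lift_fst]
      rw [hφ, reassoc_of% hl, pullback.condition]
    · simp [hl]
  · rwa [pullback.lift_fst]
  · rw [pullback.lift_fst]
    exact Subobject.factors_zero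

end Points

/-! ### Canonical morphisms described by their retractions -/

variable {C : Type u} [Category.{v} C] [HomologicalCategory C] [HasZeroMorphisms C]
  [HasFiniteColimits C]

/-- The retraction `W + X + Y ⟶ W + X`. -/
abbrev retrLeft (W X Y : C) : (W ⨿ X) ⨿ Y ⟶ W ⨿ X := coprod.desc (𝟙 _) 0

/-- The retraction `W + X + Y ⟶ W + Y`. -/
abbrev retrRight (W X Y : C) : (W ⨿ X) ⨿ Y ⟶ W ⨿ Y :=
  coprod.desc (coprod.desc coprod.inl 0) coprod.inr

/-- The retraction `W + X + Y ⟶ X + Y`. -/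
abbrev retrSum (W X Y : C) : (W ⨿ X) ⨿ Y ⟶ X ⨿ Y :=
  coprod.desc (coprod.desc 0 coprod.inl) coprod.inr

theorem comparison_fst (W X Y : C) :
    comparison W X Y ≫ pullback.fst _ _ = retrLeft W X Y := by
  ext <;> simp [comparison]

theorem comparison_snd (W X Y : C) :
    comparison W X Y ≫ pullback.snd _ _ = retrRight W X Y := by
  ext <;> simp [comparison]

theorem comp_comparison_eq_zero_iff {W X Y Z : C} (z : Z ⟶ (W ⨿ X) ⨿ Y) :
    z ≫ comparison W X Y = 0 ↔ z ≫ retrLeft W X Y = 0 ∧ z ≫ retrRight W X Y = 0 := by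
  rw [← comparison_fst, ← comparison_snd]
  refine ⟨fun h => by simp [reassoc_of% h], fun h => pullback.hom_ext ?_ ?_⟩
  · simpa using h.1
  · simpa using h.2

theorem comp_sumToProd_eq_zero_iff {X Y Z : C} (z : Z ⟶ X ⨿ Y) :
    z ≫ sumToProd X Y = 0 ↔
      z ≫ coprod.desc (𝟙 X) 0 = 0 ∧ z ≫ coprod.desc 0 (𝟙 Y) = 0 := by
  have h₁ : coprod.desc (𝟙 X) 0 = sumToProd X Y ≫ prod.fst := by ext <;> simp [sumToProd]
  have h₂ : coprod.desc 0 (𝟙 Y) = sumToProd X Y ≫ prod.snd := by ext <;> simp [sumToProd]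
  rw [h₁, h₂]
  refine ⟨fun h => by simp [reassoc_of% h], fun h => Limits.prod.hom_ext ?_ ?_⟩
  · simpa using h.1
  · simpa using h.2

theorem comp_sumToProd₃_eq_zero_iff {X Y W Z : C} (z : Z ⟶ (X ⨿ Y) ⨿ W) :
    z ≫ sumToProd₃ X Y W = 0 ↔
      z ≫ retrLeft X Y W = 0 ∧ z ≫ retrRight X Y W = 0 ∧ z ≫ retrSum X Y W = 0 := by
  have h₁ : retrLeft X Y W = sumToProd₃ X Y W ≫ prod.fst := by ext <;> simp [sumToProd₃]
  have h₂ : retrRight X Y W = sumToProd₃ X Y W ≫ prod.snd ≫ prod.fst := by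
    ext <;> simp [sumToProd₃]
  have h₃ : retrSum X Y W = sumToProd₃ X Y W ≫ prod.snd ≫ prod.snd := by
    ext <;> simp [sumToProd₃]
  rw [h₁, h₂, h₃]
  refine ⟨fun h => by simp [reassoc_of% h],
    fun h => Limits.prod.hom_ext ?_ (Limits.prod.hom_ext ?_ ?_)⟩
  · simpa using h.1
  · simpa using h.2.1
  · simpa using h.2.2

/-- The isomorphism `X + Y + W ≅ W + X + Y`. -/
def rotate (X Y W : C) : (X ⨿ Y) ⨿ W ≅ (W ⨿ X) ⨿ Y where
  hom := coprod.desc (coprod.desc (coprod.inr ≫ coprod.inl) coprod.inr)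
    (coprod.inl ≫ coprod.inl)
  inv := coprod.desc (coprod.desc coprod.inr (coprod.inl ≫ coprod.inl))
    (coprod.inr ≫ coprod.inl)
  hom_inv_id := by ext <;> simp
  inv_hom_id := by ext <;> simp

/-- Up to swapping summands, rotation matches the three retractions defining X⋄Y⋄W with those of
W+X+Y. Two of them make up the comparison morphism, so X⋄Y⋄W is the part of its kernel killed by the
third. -/
theorem rotate_hom_comp_eq_zero_iff {X Y W Z : C} (z : Z ⟶ (X ⨿ Y) ⨿ W) :
    z ≫ sumToProd₃ X Y W = 0 ↔
      (z ≫ (rotate X Y W).hom) ≫ comparison W X Y = 0 ∧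
        (z ≫ (rotate X Y W).hom) ≫ retrSum W X Y = 0 := by
  have h₁ : (rotate X Y W).hom ≫ retrSum W X Y = retrLeft X Y W := by
    ext <;> simp [rotate]
  have h₂ : (rotate X Y W).hom ≫ retrLeft W X Y = retrRight X Y W ≫ (coprod.braiding X W).hom := by
    ext <;> simp [rotate]
  have h₃ : (rotate X Y W).hom ≫ retrRight W X Y = retrSum X Y W ≫ (coprod.braiding Y W).hom := by
    ext <;> simp [rotate]
  rw [comp_sumToProd₃_eq_zero_iff, comp_comparison_eq_zero_iff]
  simp only [Category.assoc, h₁, h₂, h₃]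
  rw [← Category.assoc z (retrRight X Y W), ← Category.assoc z (retrSum X Y W),
    comp_mono_eq_zero_iff _ (coprod.braiding X W).hom,
    comp_mono_eq_zero_iff _ (coprod.braiding Y W).hom]
  tauto

/-- The weighted commutator is the join of the binary and the ternary Higgins commutators: the
kernel of the comparison morphism is a point over `X ⋄ Y` with kernel `X ⋄ Y ⋄ W`. -/
theorem weightedCommutator_eq_sup {W X Y D : C} (w : W ⟶ D) (x : X ⟶ D) (y : Y ⟶ D) :
    weightedCommutator w x y = higgins x y ⊔ higgins₃ x y w := by
  let i : X ⨿ Y ⟶ (W ⨿ X) ⨿ Y := coprod.map coprod.inr (𝟙 Y)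
  have hi : i ≫ retrSum W X Y = 𝟙 _ := by ext <;> simp [i]
  have hiL : i ≫ retrLeft W X Y = coprod.desc (𝟙 X) 0 ≫ coprod.inr := by ext <;> simp [i]
  have hiR : i ≫ retrRight W X Y = coprod.desc 0 (𝟙 Y) ≫ coprod.inr := by ext <;> simp [i]
  -- Each component of the retraction onto X+Y factors through a retraction that vanishes on K, so K
  -- lands in X⋄Y.
  have hL : retrSum W X Y ≫ coprod.desc (𝟙 X) 0 = retrLeft W X Y ≫ coprod.desc 0 (𝟙 X) := by
    ext <;> simp
  have hR : retrSum W X Y ≫ coprod.desc 0 (𝟙 Y) = retrRight W X Y ≫ coprod.desc 0 (𝟙 Y) := by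
    ext <;> simp
  have hι := (comp_comparison_eq_zero_iff _).1 (kernel.condition (comparison W X Y))
  have hκ := (comp_sumToProd_eq_zero_iff _).1 (kernel.condition (sumToProd X Y))
  let p : kernel (comparison W X Y) ⟶ coSmash X Y :=
    kernel.lift _ (kernel.ι _ ≫ retrSum W X Y) ((comp_sumToProd_eq_zero_iff _).2
      ⟨by rw [Category.assoc, hL, reassoc_of% hι.1, zero_comp],
        by rw [Category.assoc, hR, reassoc_of% hι.2, zero_comp]⟩)
  let s : coSmash X Y ⟶ kernel (comparison W X Y) :=
    kernel.lift _ (kernel.ι _ ≫ i) ((comp_comparison_eq_zero_iff _).2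
      ⟨by rw [Category.assoc, hiL, reassoc_of% hκ.1, zero_comp],
        by rw [Category.assoc, hiR, reassoc_of% hκ.2, zero_comp]⟩)
  let k : coSmash₃ X Y W ⟶ kernel (comparison W X Y) :=
    kernel.lift _ (kernel.ι _ ≫ (rotate X Y W).hom)
      ((rotate_hom_comp_eq_zero_iff _).1 (kernel.condition _)).1
  have hs : s ≫ p = 𝟙 _ := by
    rw [← cancel_mono (kernel.ι (sumToProd X Y))]
    simp only [s, p, Category.assoc, kernel.lift_ι, kernel.lift_ι_assoc, hi, Category.comp_id,
      Category.id_comp]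
  have hk : ∀ ⦃Z : C⦄ (z : Z ⟶ kernel (comparison W X Y)), z ≫ p = 0 → ∃ l, l ≫ k = z := by
    intro Z z hz
    have hz' := congrArg (fun t => t ≫ kernel.ι (sumToProd X Y)) hz
    simp only [p, Category.assoc, kernel.lift_ι, zero_comp] at hz'
    refine ⟨kernel.lift _ (z ≫ kernel.ι _ ≫ (rotate X Y W).inv)
      ((rotate_hom_comp_eq_zero_iff _).2 ⟨?_, ?_⟩), ?_⟩
    · simp
    · simpa using hz'
    · rw [← cancel_mono (kernel.ι (comparison W X Y))]
      simp [k]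
  have hx : i ≫ coprod.desc (coprod.desc w x) y = coprod.desc x y := by ext <;> simp [i]
  have hw : (rotate X Y W).hom ≫ coprod.desc (coprod.desc w x) y =
      coprod.desc (coprod.desc x y) w := by ext <;> simp [rotate]
  rw [weightedCommutator, imageSubobject_eq_sup_of_point p s hs k hk, higgins, higgins₃]
  simp only [s, k, kernel.lift_ι_assoc, Category.assoc, hx, hw]

/-! ### Invariance under extremal epimorphisms -/

/-- The morphism induced between the kernels of the comparison morphisms by a triple of extremal
epimorphisms is an extremal epimorphism. -/
theorem extremalEpi_kernel_comparison {W X Y W' X' Y' : C} (a : W ⟶ W') (b : X ⟶ X')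
    (c : Y ⟶ Y') [ExtremalEpi a] [ExtremalEpi b] [ExtremalEpi c]
    (φ : kernel (comparison W X Y) ⟶ kernel (comparison W' X' Y'))
    (hφ : φ ≫ kernel.ι _ = kernel.ι _ ≫ coprod.map (coprod.map a b) c) : ExtremalEpi φ := by
  have hmap : ExtremalEpi (coprod.map (coprod.map a b) c) := by
    have := extremalEpi_coprod_map a b
    exact extremalEpi_coprod_map _ _
  have hL : coprod.map (coprod.map a b) c ≫ retrLeft W' X' Y' =
      retrLeft W X Y ≫ coprod.map a b := by ext <;> simp
  have hR : coprod.map (coprod.map a b) c ≫ retrRight W' X' Y' =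
      retrRight W X Y ≫ coprod.map a c := by ext <;> simp
  have hret : coprod.map a c ≫ retr W' Y' = retr W Y ≫ a := by ext <;> simp
  -- First kernel: that of W+X+Y → W+X. The second is that of the split epimorphism `p` from it to
  -- the kernel of W+Y → W, and equals K. Only `ψ`, not `χ`, needs to be extremal for the second use
  -- of the point lemma.
  let ψ : kernel (retrLeft W X Y) ⟶ kernel (retrLeft W' X' Y') :=
    kernel.map _ _ (coprod.map (coprod.map a b) c) (coprod.map a b) hL.symm
  let χ : kernel (retr W Y) ⟶ kernel (retr W' Y') :=
    kernel.map _ _ (coprod.map a c) a hret.symm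
  have hψ : ExtremalEpi ψ :=
    extremalEpi_kernel_of_point (retrLeft W X Y) coprod.inl (by simp) (retrLeft W' X' Y')
      coprod.inl (coprod.map (coprod.map a b) c) (coprod.map a b) hL (by simp)
      (kernel.ι _) (fun Z z hz => ⟨kernel.lift _ z hz, kernel.lift_ι _ _ _⟩)
      (kernel.ι _) (kernel.condition _) ψ (by simp [ψ, kernel.map])
  let p (W X Y : C) : kernel (retrLeft W X Y) ⟶ kernel (retr W Y) :=
    kernel.lift _ (kernel.ι _ ≫ retrRight W X Y) (by
      have h : retrRight W X Y ≫ retr W Y = retrLeft W X Y ≫ retr W X := by ext <;> simp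
      rw [Category.assoc, h, kernel.condition_assoc, zero_comp])
  let i (W X Y : C) : W ⨿ Y ⟶ (W ⨿ X) ⨿ Y := coprod.map coprod.inl (𝟙 Y)
  have hi (W X Y : C) : i W X Y ≫ retrRight W X Y = 𝟙 _ := by ext <;> simp [i]
  let s (W X Y : C) : kernel (retr W Y) ⟶ kernel (retrLeft W X Y) :=
    kernel.lift _ (kernel.ι _ ≫ i W X Y) (by
      have h : i W X Y ≫ retrLeft W X Y = retr W Y ≫ coprod.inl := by ext <;> simp [i]
      rw [Category.assoc, h, kernel.condition_assoc, zero_comp])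
  let k (W X Y : C) : kernel (comparison W X Y) ⟶ kernel (retrLeft W X Y) :=
    kernel.lift _ (kernel.ι _) ((comp_comparison_eq_zero_iff _).1 (kernel.condition _)).1
  have hkι (W X Y : C) : k W X Y ≫ kernel.ι _ = kernel.ι _ := kernel.lift_ι _ _ _
  have hkp (W X Y : C) : k W X Y ≫ p W X Y = 0 := by
    rw [← cancel_mono (kernel.ι (retr W Y))]
    simp only [p, k, Category.assoc, kernel.lift_ι, kernel.lift_ι_assoc, zero_comp]
    exact ((comp_comparison_eq_zero_iff _).1 (kernel.condition _)).2
  have hmono : Mono (k W' X' Y') := by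
    have : Mono (k W' X' Y' ≫ kernel.ι _) := by rw [hkι]; infer_instance
    exact mono_of_mono _ (kernel.ι _)
  refine extremalEpi_kernel_of_point (p W X Y) (s W X Y) ?_ (p W' X' Y') (s W' X' Y') ψ χ ?_ ?_
    (k W X Y) ?_ (k W' X' Y') (hkp _ _ _) φ ?_
  · rw [← cancel_mono (kernel.ι (retr W Y))]
    simp only [s, p, Category.assoc, kernel.lift_ι, kernel.lift_ι_assoc, hi, Category.comp_id,
      Category.id_comp]
  · rw [← cancel_mono (kernel.ι (retr W' Y'))]
    simp only [p, ψ, χ, kernel.map, Category.assoc, kernel.lift_ι, kernel.lift_ι_assoc, hR]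
  · rw [← cancel_mono (kernel.ι (retrLeft W' X' Y'))]
    have h : i W X Y ≫ coprod.map (coprod.map a b) c = coprod.map a c ≫ i W' X' Y' := by
      ext <;> simp [i]
    simp only [s, ψ, χ, kernel.map, Category.assoc, kernel.lift_ι, kernel.lift_ι_assoc, h]
  · intro Z z hz
    have hz' := congrArg (fun t => t ≫ kernel.ι (retr W Y)) hz
    simp only [p, Category.assoc, kernel.lift_ι, zero_comp] at hz'
    refine ⟨kernel.lift _ (z ≫ kernel.ι _) ((comp_comparison_eq_zero_iff _).2
      ⟨by rw [Category.assoc, kernel.condition, comp_zero], by rw [Category.assoc, hz']⟩), ?_⟩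
    rw [← cancel_mono (kernel.ι (retrLeft W X Y)), Category.assoc, hkι, kernel.lift_ι]
  · rw [← cancel_mono (kernel.ι (retrLeft W' X' Y'))]
    simp only [ψ, kernel.map, Category.assoc, kernel.lift_ι, hkι, hφ]
    rw [reassoc_of% hkι W X Y]

theorem weightedCommutator_extremalEpi_comp {W X Y W' X' Y' D : C} (a : W ⟶ W') (b : X ⟶ X')
    (c : Y ⟶ Y') [ExtremalEpi a] [ExtremalEpi b] [ExtremalEpi c]
    (w : W' ⟶ D) (x : X' ⟶ D) (y : Y' ⟶ D) :
    weightedCommutator (a ≫ w) (b ≫ x) (c ≫ y) = weightedCommutator w x y := by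
  have hL : coprod.map (coprod.map a b) c ≫ retrLeft W' X' Y' =
      retrLeft W X Y ≫ coprod.map a b := by ext <;> simp
  have hR : coprod.map (coprod.map a b) c ≫ retrRight W' X' Y' =
      retrRight W X Y ≫ coprod.map a c := by ext <;> simp
  have hι := (comp_comparison_eq_zero_iff _).1 (kernel.condition (comparison W X Y))
  let φ : kernel (comparison W X Y) ⟶ kernel (comparison W' X' Y') :=
    kernel.lift _ (kernel.ι _ ≫ coprod.map (coprod.map a b) c)
      ((comp_comparison_eq_zero_iff _).2
        ⟨by rw [Category.assoc, hL, reassoc_of% hι.1, zero_comp],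
          by rw [Category.assoc, hR, reassoc_of% hι.2, zero_comp]⟩)
  have hφ : φ ≫ kernel.ι _ = kernel.ι _ ≫ coprod.map (coprod.map a b) c := kernel.lift_ι _ _ _
  have := extremalEpi_kernel_comparison a b c φ hφ
  have hd : coprod.desc (coprod.desc (a ≫ w) (b ≫ x)) (c ≫ y) =
      coprod.map (coprod.map a b) c ≫ coprod.desc (coprod.desc w x) y := by ext <;> simp
  rw [weightedCommutator, weightedCommutator, ← imageSubobject_extremalEpi_comp φ]
  simp only [hd, reassoc_of% hφ]

end WeightedCommutator

end

open WeightedCommutator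
/-- The second equation reads `[X, Y]` and `[X, Y, Im w]` as commutators of the subobjects `Im x`,
`Im y` and `Im w` of `D`; the first one uses `x` and `y` themselves. They are the same when `x` and
`y` are monomorphisms. -/
theorem mainTheorem1 {C : Type u} [Category.{v} C] [HomologicalCategory C] [HasZeroMorphisms C]
    [HasFiniteColimits C] {W X Y D : C} (w : W ⟶ D) (x : X ⟶ D) (y : Y ⟶ D) :
    weightedCommutator w x y = higgins x y ⊔ higgins₃ x y (image.ι w) ∧
    weightedCommutator w x y =
      higgins (image.ι x) (image.ι y) ⊔ higgins₃ (image.ι x) (image.ι y) (image.ι w) := by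
  constructor
  -- Identities on X and Y leave x and y intact while w is replaced by its image.
  · rw [← weightedCommutator_eq_sup,
      ← weightedCommutator_extremalEpi_comp (factorThruImage w) (𝟙 X) (𝟙 Y)]
    simp only [image.fac, Category.id_comp]
  · rw [← weightedCommutator_eq_sup, ← weightedCommutator_extremalEpi_comp (factorThruImage w)
      (factorThruImage x) (factorThruImage y)]
    simp only [image.fac]
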